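/- All graphs are finite and simple, and the null graph (no vertices) is allowed. A graph property is an isomorphism-closed set of graphs; it is additive if it is closed under disjoint unions, and induced-hereditary if it is closed under induced subgraphs. The product $\mathcal{P}_1 \circ \cdots \circ \mathcal{P}_m$ is the set of all graphs $G$ whose vertex set has a partition $(V_1,\dots,V_m)$ into $m$ possibly empty parts with $G[V_i] \in \mathcal{P}_i$ for every $i$. For graphs $G_1,\dots,G_n$ let $G_1 * \cdots * G_n$ be the set of all graphs obtained from the disjoint union of $G_1,\dots,G_n$ by adding any set of edges between different $G_i$'s, and let $kG$ denote the disjoint union of $k$ copies of $G$. A $\mathcal{P}$-decomposition of $G$ with $n$ parts is a partition $(V_1,\dots,V_n)$ of $V(G)$ into $n$ non-empty parts such that $kG[V_1] * \cdots * kG[V_n] \subseteq \mathcal{P}$ for all positive integers $k$. Let $dec_{\mathcal{P}}(G)$ be the maximum number of parts in a $\mathcal{P}$-decomposition of $G$ ($0$ if there is none). A graph $G$ is $\mathcal{P}$-strict if $G \in \mathcal{P}$ but $G * K_1 \not\subseteq \mathcal{P}$. Let $dec(\mathcal{P})$ be the minimum of $dec_{\mathcal{P}}(G)$ over all $\mathcal{P}$-strict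 graphs $G$ ($\infty$ if there is no $\mathcal{P}$-strict graph); $\mathcal{P}$ is indecomposable if $dec(\mathcal{P}) = 1$. **Theorem.** Let $\mathcal{P}$ be an additive induced-hereditary property, and let $\mathcal{P} = \mathcal{P}_1 \circ \cdots \circ \mathcal{P}_m$ be a factorisation of $\mathcal{P}$ into indecomposable additive induced-hereditary properties $\mathcal{P}_1,\dots,\mathcal{P}_m$. Then $m = dec(\mathcal{P})$. -/

import Mathlib

/-- A graph property: an isomorphism-closed collection of finite simple graphs (the null graph,
with no vertices, counts as a graph). -/
@[ext]
structure GraphProperty where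
  Holds : ∀ {V : Type} [Finite V], SimpleGraph V → Prop
  iso : ∀ {V W : Type} [Finite V] [Finite W] {G : SimpleGraph V} {H : SimpleGraph W},
    (G ≃g H) → Holds G → Holds H

/-- The disjoint union of a family of graphs. -/
def disjointUnion {ι : Type} {V : ι → Type} (G : ∀ i, SimpleGraph (V i)) :
    SimpleGraph (Σ i, V i) :=
  ⨆ i, (G i).map (Function.Embedding.sigmaMk i)

/-- The join of a family of graphs: the disjoint union together with all edges between
different members of the family. -/
def joinGraph {ι : Type} {V : ι → Type} (G : ∀ i, SimpleGraph (V i)) :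
    SimpleGraph (Σ i, V i) :=
  disjointUnion G ⊔ SimpleGraph.completeMultipartiteGraph V

/-- The `*`-join of a family of graphs: all graphs lying between the disjoint union and the
join. -/
def starJoin {ι : Type} {V : ι → Type} (G : ∀ i, SimpleGraph (V i)) :
    Set (SimpleGraph (Σ i, V i)) :=
  {H | disjointUnion G ≤ H ∧ H ≤ joinGraph G}

/-- The `*`-join of two graphs. -/
def starJoinTwo {V W : Type} (G : SimpleGraph V) (H : SimpleGraph W) :
    Set (SimpleGraph (V ⊕ W)) :=
  {F | G ⊕g H ≤ F ∧ F ≤ (G ⊕g H) ⊔ completeBipartiteGraph V W}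

/-- The disjoint union of `k` copies of a graph. -/
def copies {V : Type} (k : ℕ) (G : SimpleGraph V) : SimpleGraph (Σ _ : Fin k, V) :=
  disjointUnion fun _ : Fin k => G

namespace GraphProperty

/-- Closed under disjoint unions. -/
def Additive (P : GraphProperty) : Prop :=
  ∀ {V W : Type} [Finite V] [Finite W] (G : SimpleGraph V) (H : SimpleGraph W),
    P.Holds G → P.Holds H → P.Holds (G ⊕g H)

/-- Closed under induced subgraphs. -/
def InducedHereditary (P : GraphProperty) : Prop :=
  ∀ {V W : Type} [Finite V] [Finite W] (G : SimpleGraph V) (H : SimpleGraph W),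
    H.IsIndContained G → P.Holds G → P.Holds H

/-- The product of the properties `Q i`. An ordered partition into `m` possibly empty parts
is given by the function `c` that sends a vertex to the index of its part. -/
def product {m : ℕ} (Q : Fin m → GraphProperty) : GraphProperty where
  Holds {V} _ G := ∃ c : V → Fin m, ∀ i, (Q i).Holds (G.induce {v | c v = i})
  iso := by
    intro V W _ _ G H e ⟨c, hc⟩
    refine ⟨fun w => c (e.symm w), fun i => (Q i).iso ?_ (hc i)⟩
    exact
      { toEquiv := e.toEquiv.subtypeEquiv (fun v => by simp)
        map_rel_iff' := by
          intro a b
          exact e.map_rel_iff }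

/-- A `P`-decomposition of `G` with `n` parts: a partition into `n` nonempty parts
(the fibres of `c`), such that for every positive `k` the `*`-join of `k` disjoint copies of each
of the graphs induced by the parts is contained in `P`. -/
def IsDecomposition (P : GraphProperty) {V : Type} [Finite V] (G : SimpleGraph V) {n : ℕ}
    (c : V → Fin n) : Prop :=
  (∀ i, {v | c v = i}.Nonempty) ∧
    ∀ k : ℕ, 1 ≤ k →
      ∀ H ∈ starJoin (fun i : Fin n => copies k (G.induce {v | c v = i})), P.Holds H

/-- The `P`-decomposability number of a graph: the maximum number of parts in a
`P`-decomposition. The number of parts is at most the number of vertices, and the value is `0`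
if there is no `P`-decomposition, in particular if the graph is not in `P`. -/
noncomputable def decNumber (P : GraphProperty) {V : Type} [Finite V] (G : SimpleGraph V) : ℕ :=
  sSup {n | ∃ c : V → Fin n, P.IsDecomposition G c}

/-- `G` is `P`-strict: it lies in `P`, but `G * K₁` is not contained in `P`. -/
def IsStrict (P : GraphProperty) {V : Type} [Finite V] (G : SimpleGraph V) : Prop :=
  P.Holds G ∧ ¬ ∀ F ∈ starJoinTwo G (⊤ : SimpleGraph Unit), P.Holds F

/-- The decomposability number of a property: the minimum of the `P`-decomposability numbers of
the `P`-strict graphs (`⊤` if there is no `P`-strict graph). -/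
noncomputable def dec (P : GraphProperty) : ℕ∞ :=
  sInf {d | ∃ (V : Type) (_ : Finite V) (G : SimpleGraph V), P.IsStrict G ∧ d = P.decNumber G}

/-- A property is indecomposable if its decomposability number is `1`. -/
def Indecomposable (P : GraphProperty) : Prop :=
  P.dec = 1

end GraphProperty

/-! A decomposition is encoded as a labelling `b` that is `Free`: every graph formed from copies of
the blocks, with arbitrary edges between different blocks, has the property. If a strict graph sits
inside a graph with a free labelling, it meets every class (`IsStrict.exists_eq`), since otherwise a
new vertex with arbitrary adjacencies could be placed in a missed class. So its decomposability
number bounds the number of classes (`IsStrict.ncard_range_le`). Let `n` be the decomposability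
number of the product, attained by a strict graph `G₀`: no free labelling of a graph containing `G₀`
has more than `n` classes.

For `m ≤ n`, a partition witnessing membership in the product is free, and strictness forces all `m`
parts to be non-empty.

For `n ≤ m`, a vertex Ramsey argument (`IsBlowUp.exists_uniform`) replaces the separate colourings
of all blow-ups by one colouring of the base graph. Hence a free labelling with `n` classes is
distributed among the factors by some map `τ : Fin n → Fin m` (`Free.exists_factor_map`). For each
factor, adjoin a strict graph of decomposability number `1`; its vertices can be kept inside classes
that `τ` sends to that factor (`exists_free_extension`). If the number of compatible maps was
minimal beforehand, `τ` stays compatible. The part of each factor hit by `τ` is then freely labelled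
and contains a strict graph of decomposability number `1`, so it consists of a single class and `τ`
is injective. -/

/-- `F` is a blow-up of the graph `G` with blocks given by `b`: its vertices are labelled by
vertices `f x` of `G` and copy indices `idx x`, inside a block it is a disjoint union of (partial)
copies of the block, and edges only occur above pairs allowed by `N`. -/
structure IsBlowUp {V S X I : Type} (G : SimpleGraph V) (b : V → S) (N : V → V → Prop)
    (F : SimpleGraph X) (f : X → V) (idx : X → I) : Prop where
  inj : ∀ x y, f x = f y → idx x = idx y → x = y
  same : ∀ x y, b (f x) = b (f y) → (F.Adj x y ↔ idx x = idx y ∧ G.Adj (f x) (f y))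
  allowed : ∀ x y, F.Adj x y → N (f x) (f y)

/-! ### Blow-ups and vertex Ramsey theory -/

namespace IsBlowUp

variable {V S X I : Type} {G : SimpleGraph V} {b : V → S} {N : V → V → Prop}

/-- Every blow-up embeds into one in which all copies are complete. -/
theorem exists_full (hGN : ∀ u v, G.Adj u v → N u v) {F : SimpleGraph X} {f : X → V} {idx : X → I}
    (h : IsBlowUp G b N F f idx) :
    ∃ F' : SimpleGraph (V × I), IsBlowUp G b N F' Prod.fst Prod.snd ∧
      ∃ φ : F ↪g F', ∀ x, φ x = (f x, idx x) := by
  let F' : SimpleGraph (V × I) :=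
    { Adj := fun p q => (b p.1 = b q.1 ∧ p.2 = q.2 ∧ G.Adj p.1 q.1) ∨
        (b p.1 ≠ b q.1 ∧ ∃ x y, (f x, idx x) = p ∧ (f y, idx y) = q ∧ F.Adj x y)
      symm := ⟨by
        rintro p q (⟨h1, h2, h3⟩ | ⟨h1, x, y, h2, h3, h4⟩)
        · exact Or.inl ⟨h1.symm, h2.symm, h3.symm⟩
        · exact Or.inr ⟨h1.symm, y, x, h3, h2, h4.symm⟩⟩
      loopless := ⟨by
        rintro p (⟨_, _, h3⟩ | ⟨h1, _⟩)
        · exact G.loopless.irrefl _ h3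
        · exact h1 rfl⟩ }
  refine ⟨F', ⟨fun _ _ h1 h2 => Prod.ext h1 h2, ?_, ?_⟩, ⟨⟨fun x => (f x, idx x), ?_⟩, ?_⟩,
    fun x => rfl⟩
  · intro p q hb
    simp [F', hb]
  · rintro p q (⟨_, _, h3⟩ | ⟨_, x, y, rfl, rfl, h4⟩)
    · exact hGN _ _ h3
    · exact h.allowed _ _ h4
  · intro x y hxy
    simp only [Prod.mk.injEq] at hxy
    exact h.inj x y hxy.1 hxy.2
  · intro x y
    change F'.Adj (f x, idx x) (f y, idx y) ↔ F.Adj x y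
    by_cases hb : b (f x) = b (f y)
    · rw [h.same x y hb]
      simp [F', hb]
    · constructor
      · rintro (⟨h1, _⟩ | ⟨_, x', y', h2, h3, h4⟩)
        · exact absurd h1 hb
        · simp only [Prod.mk.injEq] at h2 h3
          rwa [← h.inj _ _ h2.1 h2.2, ← h.inj _ _ h3.1 h3.2]
      · intro hxy
        exact Or.inr ⟨hb, x, y, rfl, rfl, hxy⟩

/-- Any graph is a blow-up of itself. -/
theorem self (hGN : ∀ u v, G.Adj u v → N u v) : IsBlowUp G b N G id (fun _ => ()) where
  inj _ _ h _ := h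
  same _ _ _ := by simp
  allowed := hGN

/-- A blow-up of an induced subgraph is a blow-up of the whole graph. -/
theorem of_embedding {W : Type} {H : SimpleGraph W} (φ : H ↪g G) {F : SimpleGraph X} {f : X → W}
    {idx : X → I} (h : IsBlowUp H (b ∘ φ) (fun u v => N (φ u) (φ v)) F f idx) :
    IsBlowUp G b N F (φ ∘ f) idx where
  inj x y h1 h2 := h.inj x y (φ.injective h1) h2
  same x y hb := by rw [h.same x y hb]; simp
  allowed := h.allowed

theorem mono_allowed {N' : V → V → Prop} (hN : ∀ u v, N u v → N' u v) {F : SimpleGraph X}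
    {f : X → V} {idx : X → I} (h : IsBlowUp G b N F f idx) : IsBlowUp G b N' F f idx :=
  ⟨h.inj, h.same, fun x y hxy => hN _ _ (h.allowed x y hxy)⟩

/-- The part of a blow-up above a set of vertices is a blow-up of the induced subgraph. -/
theorem induce {F : SimpleGraph X} {f : X → V} {idx : X → I} (h : IsBlowUp G b N F f idx)
    (s : Set V) :
    IsBlowUp (G.induce s) (b ∘ Subtype.val) (fun u v => N u v) (F.induce (f ⁻¹' s))
      (fun x => ⟨f x.1, x.2⟩) (fun x => idx x.1) where
  inj _ _ h1 h2 := Subtype.ext (h.inj _ _ (congrArg Subtype.val h1) h2)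
  same x y hb := h.same x.1 y.1 hb
  allowed x y hxy := h.allowed x.1 y.1 hxy

/-- A vertex Ramsey step: one block can be made uniformly coloured. -/
theorem exists_uniform_block {R : Type} [Finite V] [Finite R] [Finite I] [Nonempty (V → R)]
    (hGN : ∀ u v, G.Adj u v → N u v) {F : SimpleGraph (V × I)}
    (hF : IsBlowUp G b N F Prod.fst Prod.snd) (s : S) :
    ∃ (J : Type) (_ : Finite J) (F' : SimpleGraph (V × J)),
      IsBlowUp G b N F' Prod.fst Prod.snd ∧ ∀ χ : V × J → R, ∃ (d : V → R) (φ : F ↪g F'),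
        (∀ p, (φ p).1 = p.1) ∧ ∀ p, b p.1 = s → χ (φ p) = d p.1 := by
  classical
  have hE : Finite (I ↪ I × (V → R)) := DFunLike.finite _
  -- Block `s` gets `|I| * |R| ^ |V|` copies, enough for the pigeonhole principle. Every way `ε` of
  -- selecting `I` of them gets its own private copies of all the other blocks.
  let view : (I ↪ I × (V → R)) → V × I → V × ((I × (V → R)) ⊕ (I × (I ↪ I × (V → R)))) := fun ε p =>
    (p.1, if b p.1 = s then Sum.inl (ε p.2) else Sum.inr (p.2, ε))
  have view_inj : ∀ ε, Function.Injective (view ε) := by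
    intro ε p q hpq
    have h1 : (view ε p).1 = (view ε q).1 := congrArg Prod.fst hpq
    change p.1 = q.1 at h1
    have h2 := congrArg Prod.snd hpq
    refine Prod.ext h1 ?_
    by_cases hb : b q.1 = s
    · simpa [view, h1, hb] using h2
    · simpa [view, h1, hb] using h2
  -- An edge between different blocks has an end outside `s`, and that end determines `ε`; so
  -- different views do not interfere.
  have view_eq : ∀ ε ε' p p', b p.1 ≠ s → view ε p = view ε' p' → ε = ε' := by
    intro ε ε' p p' hb h
    have h1 : (view ε p).1 = (view ε' p').1 := congrArg Prod.fst h
    change p.1 = p'.1 at h1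
    have h2 := congrArg Prod.snd h
    have hb' : b p'.1 ≠ s := h1 ▸ hb
    simp only [view, if_neg hb, if_neg hb', Sum.inr.injEq, Prod.mk.injEq] at h2
    exact h2.2
  let F' : SimpleGraph (V × ((I × (V → R)) ⊕ (I × (I ↪ I × (V → R))))) :=
    { Adj := fun p q => (b p.1 = b q.1 ∧ p.2 = q.2 ∧ G.Adj p.1 q.1) ∨
        (b p.1 ≠ b q.1 ∧ ∃ ε x y, view ε x = p ∧ view ε y = q ∧ F.Adj x y)
      symm := ⟨by
        rintro p q (⟨h1, h2, h3⟩ | ⟨h1, ε, x, y, h2, h3, h4⟩)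
        · exact Or.inl ⟨h1.symm, h2.symm, h3.symm⟩
        · exact Or.inr ⟨h1.symm, ε, y, x, h3, h2, h4.symm⟩⟩
      loopless := ⟨by
        rintro p (⟨_, _, h3⟩ | ⟨h1, _⟩)
        · exact G.loopless.irrefl _ h3
        · exact h1 rfl⟩ }
  refine ⟨_, inferInstance, F', ⟨fun _ _ h1 h2 => Prod.ext h1 h2, ?_, ?_⟩, ?_⟩
  · intro p q hb
    simp [F', hb]
  · rintro p q (⟨_, _, h3⟩ | ⟨_, ε, x, y, rfl, rfl, h4⟩)
    · exact hGN _ _ h3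
    · exact hF.allowed _ _ h4
  intro χ
  have := Fintype.ofFinite I
  have := Fintype.ofFinite V
  have := Fintype.ofFinite R
  -- At least `|I|` copies of block `s` carry the same colour pattern `d`; `ε` selects them.
  obtain ⟨d, hd⟩ := Fintype.exists_le_card_fiber_of_mul_le_card (n := Fintype.card I)
    (fun k : I × (V → R) => fun v => χ (v, Sum.inl k))
    (by simp only [Fintype.card_prod]; exact (mul_comm _ _).le)
  obtain ⟨ε₀⟩ : Nonempty (I ↪ {k : I × (V → R) // (fun v => χ (v, Sum.inl k)) = d}) := by
    apply Function.Embedding.nonempty_of_card_le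
    rw [Fintype.card_subtype]
    exact hd
  let ε : I ↪ I × (V → R) := ε₀.trans (Function.Embedding.subtype _)
  have hε : ∀ i v, χ (v, Sum.inl (ε i)) = d v := fun i v => congrFun (ε₀ i).2 v
  refine ⟨d, ⟨⟨view ε, view_inj ε⟩, ?_⟩, fun p => rfl, ?_⟩
  · intro p q
    change F'.Adj (view ε p) (view ε q) ↔ F.Adj p q
    by_cases hb : b p.1 = b q.1
    · rw [hF.same p q hb]
      by_cases hs : b q.1 = s
      · simp [F', hb, view, hs]
      · simp [F', hb, view, hs]
    · constructor
      · rintro (⟨h1, _⟩ | ⟨_, ε', x, y, h2, h3, h4⟩)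
        · exact absurd h1 hb
        · have hεε : ε = ε' := by
            by_cases hs : b p.1 = s
            · exact view_eq ε ε' q y (fun h => hb (hs.trans h.symm)) h3.symm
            · exact view_eq ε ε' p x hs h2.symm
          subst hεε
          rwa [← view_inj ε h2, ← view_inj ε h3]
      · intro hpq
        exact Or.inr ⟨hb, ε, p, q, rfl, rfl, hpq⟩
  · intro p hs
    change χ (view ε p) = d p.1
    simp only [view, if_pos hs]
    exact hε _ _

/-- Vertex Ramsey theorem for blow-ups. -/
theorem exists_ramsey {R : Type} [Finite V] [Finite R] [Nonempty (V → R)]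
    (hGN : ∀ u v, G.Adj u v → N u v) (T : Finset S) {I : Type} [Finite I]
    {F : SimpleGraph (V × I)} (hF : IsBlowUp G b N F Prod.fst Prod.snd) :
    ∃ (J : Type) (_ : Finite J) (F' : SimpleGraph (V × J)),
      IsBlowUp G b N F' Prod.fst Prod.snd ∧ ∀ χ : V × J → R, ∃ (d : V → R) (φ : F ↪g F'),
        (∀ p, (φ p).1 = p.1) ∧ ∀ p, b p.1 ∈ T → χ (φ p) = d p.1 := by
  classical
  induction T using Finset.induction_on generalizing I with
  | empty =>
    exact ⟨I, inferInstance, F, hF, fun χ =>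
      ⟨Classical.arbitrary _, SimpleGraph.Embedding.refl, fun _ => rfl, by simp⟩⟩
  | insert s T _ ih =>
    obtain ⟨J₁, _, F₁, hF₁, h₁⟩ := exists_uniform_block (R := R) hGN hF s
    obtain ⟨J₂, _, F₂, hF₂, h₂⟩ := ih hF₁
    refine ⟨J₂, inferInstance, F₂, hF₂, fun χ => ?_⟩
    obtain ⟨d₂, φ₂, hφ₂, hd₂⟩ := h₂ χ
    obtain ⟨d₁, φ₁, hφ₁, hd₁⟩ := h₁ (χ ∘ φ₂)
    refine ⟨fun v => if b v = s then d₁ v else d₂ v, φ₂.comp φ₁, fun p => ?_, fun p hp => ?_⟩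
    · exact (hφ₂ _).trans (hφ₁ p)
    · by_cases hs : b p.1 = s
      · simpa [hs] using hd₁ p hs
      · have hT : b (φ₁ p).1 ∈ T := by
          rw [hφ₁]
          exact (Finset.mem_insert.1 hp).resolve_left hs
        have := hd₂ (φ₁ p) hT
        rw [hφ₁] at this
        simpa [hs] using this

/-- If all full blow-ups have a good colouring, then there is a colouring of the base graph whose
lift to every blow-up is good. -/
theorem exists_uniform {R : Type} [Finite V] [Finite R]
    (hGN : ∀ u v, G.Adj u v → N u v)
    (Good : ∀ {X : Type} [Finite X], SimpleGraph X → (X → R) → Prop)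
    (hher : ∀ {X Y : Type} [Finite X] [Finite Y] {F : SimpleGraph X} {F' : SimpleGraph Y}
      (φ : F ↪g F') (χ : Y → R), Good F' χ → Good F (χ ∘ φ))
    (hex : ∀ {I : Type} [Finite I] (F : SimpleGraph (V × I)),
      IsBlowUp G b N F Prod.fst Prod.snd → ∃ χ, Good F χ) :
    ∃ d : V → R, ∀ {X I : Type} [Finite X] [Finite I] (F : SimpleGraph X) (f : X → V)
      (idx : X → I), IsBlowUp G b N F f idx → Good F (d ∘ f) := by
  classical
  have hne : Nonempty (V → R) := by
    obtain ⟨F', hF', φ, -⟩ := exists_full hGN (self (b := b) hGN)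
    obtain ⟨χ, -⟩ := hex F' hF'
    exact ⟨χ ∘ φ⟩
  by_contra hcon
  have hbad : ∀ d : V → R, ∃ (I : Type) (_ : Finite I) (F : SimpleGraph (V × I)),
      IsBlowUp G b N F Prod.fst Prod.snd ∧ ¬ Good F (d ∘ Prod.fst) := by
    intro d
    by_contra h
    apply hcon
    refine ⟨d, ?_⟩
    intro X I _ _ F f idx hF
    by_contra hg
    obtain ⟨F', hF', φ, hφ⟩ := exists_full hGN hF
    refine h ⟨I, inferInstance, F', hF', fun hg' => hg ?_⟩
    have := hher φ _ hg'
    convert this using 1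
    funext x
    simp [hφ]
  choose I hI F hF hbad using hbad
  -- There are only finitely many `d`, so the disjoint union of their counterexamples is one finite
  -- blow-up. A uniformly coloured copy of it, with pattern `d`, contains the counterexample to that
  -- same `d`.
  let F₀ : SimpleGraph (V × (Σ d, I d)) :=
    { Adj := fun p q => ∃ d i j, p.2 = ⟨d, i⟩ ∧ q.2 = ⟨d, j⟩ ∧ (F d).Adj (p.1, i) (q.1, j)
      symm := ⟨by
        rintro p q ⟨d, i, j, h1, h2, h3⟩
        exact ⟨d, j, i, h2, h1, h3.symm⟩⟩
      loopless := ⟨by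
        rintro ⟨v, d', i'⟩ ⟨d, i, j, h1, h2, h3⟩
        simp only at h1 h2 h3
        rw [h1] at h2
        simp only [Sigma.mk.injEq, heq_eq_eq, true_and] at h2
        subst h2
        exact (F d).loopless.irrefl _ h3⟩ }
  have hadj : ∀ d v w i j, F₀.Adj (v, ⟨d, i⟩) (w, ⟨d, j⟩) ↔ (F d).Adj (v, i) (w, j) := by
    intro d v w i j
    constructor
    · rintro ⟨d', i', j', h1, h2, h3⟩
      simp only [Sigma.mk.injEq] at h1 h2
      obtain ⟨rfl, h1⟩ := h1
      obtain ⟨_, h2⟩ := h2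
      rw [eq_of_heq h1, eq_of_heq h2]
      exact h3
    · exact fun h => ⟨d, i, j, rfl, rfl, h⟩
  have hF₀ : IsBlowUp G b N F₀ Prod.fst Prod.snd := by
    refine ⟨fun x y h1 h2 => Prod.ext h1 h2, ?_, ?_⟩
    · rintro ⟨v, d, i⟩ ⟨w, d', j⟩ hb
      by_cases hd : d = d'
      · subst hd
        rw [hadj, (hF d).same _ _ hb]
        simp
      · constructor
        · rintro ⟨d₁, i', j', h1, h2, -⟩
          exact absurd ((congrArg Sigma.fst h1).trans (congrArg Sigma.fst h2).symm) hd
        · rintro ⟨h1, -⟩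
          exact absurd (congrArg Sigma.fst h1) hd
    · rintro p q ⟨d, i, j, -, -, h3⟩
      exact (hF d).allowed _ _ h3
  have : Fintype V := Fintype.ofFinite V
  obtain ⟨J, _, F', hF', hram⟩ :=
    exists_ramsey (R := R) hGN (Finset.univ.image b) hF₀
  obtain ⟨χ, hχ⟩ := hex F' hF'
  obtain ⟨d, φ, -, hd⟩ := hram χ
  let ψ : F d ↪g F₀ :=
    { toFun := fun p => (p.1, ⟨d, p.2⟩)
      inj' := by
        rintro ⟨v, i⟩ ⟨w, j⟩ h
        simpa using h
      map_rel_iff' := by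
        rintro ⟨v, i⟩ ⟨w, j⟩
        exact hadj d v w i j }
  apply hbad d
  have := hher (φ.comp ψ) χ hχ
  convert this using 1
  funext p
  exact (hd (ψ p) (by simp)).symm

end IsBlowUp

/-! ### Free labellings and decompositions -/

namespace GraphProperty

variable {P : GraphProperty}

/-- All blow-ups of `G` with respect to the partition given by `b` have the property `P`. -/
def Free (P : GraphProperty) {V S : Type} (G : SimpleGraph V) (b : V → S) : Prop :=
  ∀ {X I : Type} [Finite X] [Finite I] (F : SimpleGraph X) (f : X → V) (idx : X → I),
    IsBlowUp G b (fun _ _ => True) F f idx → P.Holds F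

theorem InducedHereditary.of_embedding (hP : P.InducedHereditary) {V W : Type} [Finite V] [Finite W]
    {G : SimpleGraph V} {H : SimpleGraph W} (φ : H ↪g G) (h : P.Holds G) : P.Holds H :=
  hP G H ⟨φ⟩ h

namespace Free

variable {V S : Type} {G : SimpleGraph V} {b : V → S}

/-- Merging blocks puts more conditions on a blow-up, so there are fewer blow-ups to check. -/
theorem mono {S' : Type} {b' : V → S'} (h : P.Free G b)
    (hb : ∀ u v, b u = b v → b' u = b' v) : P.Free G b' := by
  intro X I _ _ F f idx hF
  exact h F f idx ⟨hF.inj, fun x y hxy => hF.same x y (hb _ _ hxy), hF.allowed⟩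

theorem of_embedding {W : Type} {H : SimpleGraph W} (h : P.Free G b) (φ : H ↪g G) :
    P.Free H (b ∘ φ) := by
  intro X I _ _ F f idx hF
  exact h F (φ ∘ f) idx (IsBlowUp.of_embedding φ hF)

end Free

section Decomposition

theorem disjointUnion_adj {ι : Type} {V : ι → Type} (G : ∀ i, SimpleGraph (V i)) (p q : Σ i, V i) :
    (disjointUnion G).Adj p q ↔ ∃ i x y, (G i).Adj x y ∧ p = ⟨i, x⟩ ∧ q = ⟨i, y⟩ := by
  simp only [disjointUnion, SimpleGraph.iSup_adj, SimpleGraph.map_adj]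
  constructor
  · rintro ⟨i, x, y, h, rfl, rfl⟩
    exact ⟨i, x, y, h, rfl, rfl⟩
  · rintro ⟨i, x, y, h, rfl, rfl⟩
    exact ⟨i, x, y, h, rfl, rfl⟩

theorem disjointUnion_adj_same {ι : Type} {V : ι → Type} (G : ∀ i, SimpleGraph (V i)) (i : ι)
    (x y : V i) : (disjointUnion G).Adj ⟨i, x⟩ ⟨i, y⟩ ↔ (G i).Adj x y := by
  rw [disjointUnion_adj]
  constructor
  · rintro ⟨j, x', y', h, h1, h2⟩
    obtain ⟨rfl, h1⟩ := Sigma.mk.inj h1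
    obtain ⟨_, h2⟩ := Sigma.mk.inj h2
    rwa [eq_of_heq h1, eq_of_heq h2]
  · exact fun h => ⟨i, x, y, h, rfl, rfl⟩

theorem copies_adj {V : Type} (k : ℕ) (G : SimpleGraph V) (p q : Σ _ : Fin k, V) :
    (copies k G).Adj p q ↔ p.1 = q.1 ∧ G.Adj p.2 q.2 := by
  rw [copies, disjointUnion_adj]
  constructor
  · rintro ⟨i, x, y, h, rfl, rfl⟩
    exact ⟨rfl, h⟩
  · obtain ⟨i, x⟩ := p
    obtain ⟨j, y⟩ := q
    rintro ⟨h1, h2⟩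
    obtain rfl : i = j := h1
    exact ⟨i, x, y, h2, rfl, rfl⟩

theorem IsDecomposition.free (hP : P.InducedHereditary) {V : Type} [Finite V] {G : SimpleGraph V}
    {n : ℕ} {c : V → Fin n} (h : P.IsDecomposition G c) : P.Free G c := by
  intro X I _ _ F f idx hF
  obtain ⟨F', hF', φ, hφ⟩ := IsBlowUp.exists_full (fun _ _ _ => trivial) hF
  obtain ⟨k, ⟨e⟩⟩ := Finite.exists_equiv_fin I
  -- The index type `I` may be empty, whereas a decomposition only speaks about a positive number of
  -- copies.
  let K := k + 1
  let up : I → Fin K := fun i => (e i).castSucc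
  have hup : Function.Injective up := (Fin.castSucc_injective k).comp e.injective
  let H : SimpleGraph (Σ i : Fin n, Σ _ : Fin K, {v | c v = i}) :=
    { Adj := fun p q => (p.1 = q.1 ∧ p.2.1 = q.2.1 ∧ G.Adj p.2.2.1 q.2.2.1) ∨
        (p.1 ≠ q.1 ∧ ∃ x y, f x = p.2.2.1 ∧ f y = q.2.2.1 ∧ up (idx x) = p.2.1 ∧
          up (idx y) = q.2.1 ∧ F.Adj x y)
      symm := ⟨by
        rintro p q (⟨h1, h2, h3⟩ | ⟨h1, x, y, h2, h3, h4, h5, h6⟩)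
        · exact Or.inl ⟨h1.symm, h2.symm, h3.symm⟩
        · exact Or.inr ⟨h1.symm, y, x, h3, h2, h5, h4, h6.symm⟩⟩
      loopless := ⟨by
        rintro p (⟨_, _, h3⟩ | ⟨h1, _⟩)
        · exact G.loopless.irrefl _ h3
        · exact h1 rfl⟩ }
  have hmem : H ∈ starJoin (fun i : Fin n => copies K (G.induce {v | c v = i})) := by
    constructor
    · intro p q hpq
      obtain ⟨i, x, y, hxy, rfl, rfl⟩ := (disjointUnion_adj _ _ _).1 hpq
      obtain ⟨h1, h2⟩ := (copies_adj _ _ _ _).1 hxy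
      exact Or.inl ⟨rfl, h1, h2⟩
    · rintro ⟨i, x⟩ ⟨j, y⟩ (⟨h1, h2, h3⟩ | ⟨h1, -⟩)
      · left
        obtain rfl : i = j := h1
        rw [disjointUnion_adj_same, copies_adj]
        exact ⟨h2, h3⟩
      · right
        exact h1
  refine hP.of_embedding (?_ : F ↪g H) (h.2 K (Nat.succ_pos k) H hmem)
  refine ⟨⟨fun x => ⟨c (f x), up (idx x), f x, rfl⟩, ?_⟩, ?_⟩
  · intro x y hxy
    have h1 := congrArg (fun p : Σ i : Fin n, Σ _ : Fin K, {v | c v = i} => p.2.1) hxy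
    have h2 := congrArg (fun p : Σ i : Fin n, Σ _ : Fin K, {v | c v = i} => p.2.2.1) hxy
    exact hF.inj x y h2 (hup h1)
  · intro x y
    change ((c (f x) = c (f y) ∧ up (idx x) = up (idx y) ∧ G.Adj (f x) (f y)) ∨
        (c (f x) ≠ c (f y) ∧ ∃ x' y', f x' = f x ∧ f y' = f y ∧ up (idx x') = up (idx x) ∧
          up (idx y') = up (idx y) ∧ F.Adj x' y')) ↔ F.Adj x y
    by_cases hc : c (f x) = c (f y)
    · simp [hc, hF.same x y hc, hup.eq_iff]
    · constructor
      · rintro (⟨h1, _⟩ | ⟨_, x', y', h1, h2, h3, h4, h5⟩)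
        · exact absurd h1 hc
        · rwa [← hF.inj _ _ h1 (hup h3), ← hF.inj _ _ h2 (hup h4)]
      · exact fun hxy => Or.inr ⟨hc, x, y, rfl, rfl, rfl, rfl, hxy⟩

theorem Free.isDecomposition {V : Type} [Finite V] {G : SimpleGraph V} {n : ℕ} {c : V → Fin n}
    (h : P.Free G c) (hc : Function.Surjective c) : P.IsDecomposition G c := by
  refine ⟨hc, fun k _ H hH => h H (fun p => p.2.2.1) (fun p => p.2.1) ⟨?_, ?_, by simp⟩⟩
  · rintro ⟨i, a, v, rfl⟩ ⟨j, b, w, rfl⟩ h1 h2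
    simp only at h1 h2
    subst h1 h2
    rfl
  · rintro ⟨i, a, v, rfl⟩ ⟨j, b, w, rfl⟩ hvw
    simp only at hvw
    constructor
    · intro hadj
      rcases hH.2 hadj with h1 | h1
      · obtain ⟨l, x, y, hxy, h2, h3⟩ := (disjointUnion_adj _ _ _).1 h1
        obtain ⟨h4, h5⟩ := (copies_adj _ _ _ _).1 hxy
        have e1 := congrArg (fun p : Σ i : Fin n, Σ _ : Fin k, {v | c v = i} => p.2.1) h2
        have e2 := congrArg (fun p : Σ i : Fin n, Σ _ : Fin k, {v | c v = i} => p.2.1) h3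
        have e3 := congrArg (fun p : Σ i : Fin n, Σ _ : Fin k, {v | c v = i} => p.2.2.1) h2
        have e4 := congrArg (fun p : Σ i : Fin n, Σ _ : Fin k, {v | c v = i} => p.2.2.1) h3
        simp only at e1 e2 e3 e4
        refine ⟨e1.trans (h4.trans e2.symm), ?_⟩
        simp only [e3, e4]
        exact h5
      · exact absurd hvw h1
    · rintro ⟨h1, h2⟩
      apply hH.1
      rw [disjointUnion_adj]
      refine ⟨c w, ⟨a, v, hvw⟩, ⟨b, w, rfl⟩, ?_, ?_, rfl⟩
      · rw [copies_adj]
        exact ⟨h1, h2⟩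
      · have : ∀ (i : Fin n) (h : c v = i), (⟨c v, a, ⟨v, rfl⟩⟩ :
            Σ i : Fin n, Σ _ : Fin k, {v | c v = i}) = ⟨i, a, ⟨v, h⟩⟩ := by
          rintro i rfl
          rfl
        exact this _ hvw

theorem bddAbove_decomposition (P : GraphProperty) {V : Type} [Finite V] (G : SimpleGraph V) :
    BddAbove {n | ∃ c : V → Fin n, P.IsDecomposition G c} := by
  refine ⟨Nat.card V, ?_⟩
  rintro n ⟨c, hc⟩
  simpa using Nat.card_le_card_of_surjective c (fun i => hc.1 i)

theorem Free.ncard_range_le {V S : Type} [Finite V] {G : SimpleGraph V} {b : V → S}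
    (h : P.Free G b) : (Set.range b).ncard ≤ P.decNumber G := by
  obtain ⟨k, ⟨e⟩⟩ := Finite.exists_equiv_fin (Set.range b)
  have hk : (Set.range b).ncard = k := by
    rw [← Nat.card_coe_set_eq, Nat.card_congr e, Nat.card_fin]
  rw [hk]
  refine le_csSup (bddAbove_decomposition P G) ⟨fun v => e ⟨b v, v, rfl⟩, ?_⟩
  refine Free.isDecomposition (h.mono fun u v huv => by simp [huv]) fun i => ?_
  obtain ⟨v, hv⟩ := (e.symm i).2
  exact ⟨v, by simp [hv]⟩

theorem exists_free_of_le_decNumber (hP : P.InducedHereditary) {V : Type} [Finite V]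
    {G : SimpleGraph V} {n : ℕ} (hn : 1 ≤ n) (h : n ≤ P.decNumber G) :
    ∃ c : V → Fin n, Function.Surjective c ∧ P.Free G c := by
  have hne : {n | ∃ c : V → Fin n, P.IsDecomposition G c}.Nonempty := by
    by_contra hemp
    rw [Set.not_nonempty_iff_eq_empty] at hemp
    rw [decNumber, hemp] at h
    simp at h
    omega
  obtain ⟨c, hc⟩ := Nat.sSup_mem hne (bddAbove_decomposition P G)
  have : Nonempty (Fin n) := ⟨⟨0, hn⟩⟩
  -- A left inverse of the inclusion of `Fin n` merges the surplus parts of a maximum decomposition.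
  have hinv := Function.invFun_surjective (Fin.castLE_injective h)
  refine ⟨Function.invFun (Fin.castLE h) ∘ c, hinv.comp fun i => hc.1 i, ?_⟩
  exact Free.mono (hc.free hP) fun u v huv => congrArg (Function.invFun (Fin.castLE h)) huv

end Decomposition

/-! ### Strict graphs -/

section Strict

theorem IsStrict.mono (hP : P.InducedHereditary) {V W : Type} [Finite V] [Finite W]
    {G : SimpleGraph V} {F : SimpleGraph W} (h : P.IsStrict G) (φ : G ↪g F) (hF : P.Holds F) :
    P.IsStrict F := by
  refine ⟨hF, fun hall => h.2 fun E hE => ?_⟩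
  let ψ : V ⊕ Unit ↪ W ⊕ Unit := φ.toEmbedding.sumMap (Function.Embedding.refl _)
  let E' : SimpleGraph (W ⊕ Unit) := (F ⊕g (⊤ : SimpleGraph Unit)) ⊔ E.map ψ
  have hE' : E' ∈ starJoinTwo F (⊤ : SimpleGraph Unit) := by
    refine ⟨le_sup_left, sup_le le_sup_left ?_⟩
    rw [SimpleGraph.map_le_iff_le_comap]
    intro x y hxy
    have := hE.2 hxy
    rcases x with x | x <;> rcases y with y | y <;> simp_all [ψ]
  refine hP.of_embedding (?_ : E ↪g E') (hall E' hE')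
  refine ⟨ψ, ?_⟩
  intro x y
  constructor
  · rintro (h1 | h1)
    · apply hE.1
      rcases x with x | x <;> rcases y with y | y <;> simp_all [ψ]
    · exact SimpleGraph.map_adj_apply.1 h1
  · exact fun hxy => Or.inr (SimpleGraph.map_adj_apply.2 hxy)

/-- In a free partition of a supergraph, a strict graph meets every part. -/
theorem IsStrict.exists_eq {V W S : Type} [Finite V] {G : SimpleGraph V} {F : SimpleGraph W}
    (h : P.IsStrict G) (φ : G ↪g F) {c : W → S} (hc : P.Free F c) (w : W) :
    ∃ v, c (φ v) = c w := by
  by_contra! hcon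
  -- The vertex added to `G` is labelled `w`; as no vertex of `G` shares its block, its edges are
  -- unrestricted.
  refine h.2 fun E hE => hc E (Sum.elim φ fun _ => w) (fun _ => ()) ⟨?_, ?_, by simp⟩
  · rintro (x | x) (y | y) hxy -
    · exact congrArg _ (φ.injective hxy)
    · exact absurd (congrArg c hxy) (hcon x)
    · exact absurd (congrArg c hxy).symm (hcon y)
    · rfl
  · rintro (x | x) (y | y) hxy
    · have h1 : E.Adj (Sum.inl x) (Sum.inl y) ↔ G.Adj x y :=
        ⟨fun h => by simpa using hE.2 h, fun h => hE.1 (by simpa using h)⟩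
      simp [h1]
    · exact absurd hxy (hcon x)
    · exact absurd hxy.symm (hcon y)
    · simp

theorem IsStrict.ncard_range_le {V W S : Type} [Finite V] {G : SimpleGraph V}
    {F : SimpleGraph W} (h : P.IsStrict G) (φ : G ↪g F) {c : W → S} (hc : P.Free F c) :
    (Set.range c).ncard ≤ P.decNumber G := by
  have : Set.range c = Set.range (c ∘ φ) := by
    ext s
    constructor
    · rintro ⟨w, rfl⟩
      exact h.exists_eq φ hc w
    · rintro ⟨v, rfl⟩
      exact ⟨_, rfl⟩
  rw [this]
  exact Free.ncard_range_le (hc.of_embedding φ)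

/-- If there is no strict graph, then every graph has the property. -/
theorem holds_of_forall_not_isStrict {V₀ : Type} [Finite V₀] {G₀ : SimpleGraph V₀}
    (hP : P.InducedHereditary) (h₀ : P.Holds G₀)
    (h : ∀ (V : Type) [Finite V] (G : SimpleGraph V), ¬ P.IsStrict G) :
    ∀ {V : Type} [Finite V] (G : SimpleGraph V), P.Holds G := by
  intro V hV G
  suffices hsuff : ∀ [Finite V] (G : SimpleGraph V), P.Holds G from hsuff G
  refine Finite.induction_empty_option (P := fun V => ∀ [Finite V] (G : SimpleGraph V), P.Holds G)
    ?_ ?_ ?_ V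
  · intro α β e ih _ G
    have : Finite α := Finite.of_equiv β e.symm
    exact P.iso (SimpleGraph.Iso.comap e G) (ih _)
  · intro _ G
    exact hP.of_embedding ⟨⟨PEmpty.elim, fun x => x.elim⟩, fun {x} => x.elim⟩ h₀
  · intro α _ ih _ G
    have hs := h α (G.comap some)
    rw [IsStrict, not_and, not_not] at hs
    let e := Equiv.optionEquivSumPUnit.{0, 0} α
    refine P.iso (SimpleGraph.Iso.comap e.symm G) (hs (ih _) _ ⟨?_, ?_⟩)
    · rintro (x | x) (y | y) <;> simp [e]
    · rintro (x | x) (y | y) <;> simp [e]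

end Strict

end GraphProperty

/-! ### Additivity and products -/

namespace GraphProperty

section Additive

variable {Q : GraphProperty}

theorem Additive.holds_of_split (hA : Q.Additive) {X : Type} [Finite X] {F : SimpleGraph X}
    (s : Set X) (hs : ∀ x y, F.Adj x y → (x ∈ s ↔ y ∈ s)) (h₁ : Q.Holds (F.induce s))
    (h₂ : Q.Holds (F.induce sᶜ)) : Q.Holds F := by
  classical
  refine Q.iso ⟨Equiv.Set.sumCompl s, ?_⟩ (hA _ _ h₁ h₂)
  rintro (⟨x, hx⟩ | ⟨x, hx⟩) (⟨y, hy⟩ | ⟨y, hy⟩)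
  · simp
  · simpa using fun h => hy ((hs x y h).1 hx)
  · simpa using fun h => hx ((hs x y h).2 hy)
  · simp

theorem Additive.holds_of_fibers (hA : Q.Additive) (hH : Q.InducedHereditary)
    (hne : Q.Holds (⊥ : SimpleGraph Empty)) {X K : Type} [Finite X] [Finite K] {F : SimpleGraph X}
    (g : X → K) (hg : ∀ x y, F.Adj x y → g x = g y) (h : ∀ k, Q.Holds (F.induce (g ⁻¹' {k}))) :
    Q.Holds F := by
  classical
  have : Fintype K := Fintype.ofFinite K
  have key : ∀ T : Finset K, Q.Holds (F.induce {x | g x ∈ T}) := by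
    intro T
    induction T using Finset.induction_on with
    | empty =>
      refine hH.of_embedding ⟨⟨fun x => absurd x.2 (by simp), ?_⟩, ?_⟩ hne
      · intro x
        exact absurd x.2 (by simp)
      · intro x
        exact absurd x.2 (by simp)
    | insert k T _ ih =>
      refine hA.holds_of_split {x | g x.1 = k} ?_ ?_ ?_
      · intro x y hxy
        simp [hg x.1 y.1 hxy]
      · refine hH.of_embedding ⟨⟨fun x => ⟨x.1.1, x.2⟩, ?_⟩, ?_⟩ (h k)
        · intro x y hxy
          simpa [Subtype.ext_iff] using hxy
        · exact Iff.rfl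
      · refine hH.of_embedding ⟨⟨fun x =>
          ⟨x.1.1, (Finset.mem_insert.1 x.1.2).resolve_left x.2⟩, ?_⟩, ?_⟩ ih
        · intro x y hxy
          simpa [Subtype.ext_iff] using hxy
        · exact Iff.rfl
  exact hH.of_embedding ⟨⟨fun x => ⟨x, by simp⟩, fun x y hxy => congrArg Subtype.val hxy⟩, Iff.rfl⟩
    (key Finset.univ)

theorem InducedHereditary.holds_empty (hH : Q.InducedHereditary) {V : Type} [Finite V]
    {G : SimpleGraph V} (h : Q.Holds G) : Q.Holds (⊥ : SimpleGraph Empty) :=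
  hH.of_embedding ⟨⟨Empty.elim, fun x => x.elim⟩, fun {x} => x.elim⟩ h

/-- With a single block, a blow-up is a disjoint union of induced subgraphs of `G`, one for each
index. -/
theorem Additive.free_of_const (hA : Q.Additive) (hH : Q.InducedHereditary) {V S : Type} [Finite V]
    {G : SimpleGraph V} {b : V → S} (hb : ∀ u v, b u = b v) (h : Q.Holds G) : Q.Free G b := by
  intro X I _ _ F f idx hF
  refine hA.holds_of_fibers hH (hH.holds_empty h) idx ?_ fun k => ?_
  · exact fun x y hxy => ((hF.same x y (hb _ _)).1 hxy).1
  · refine hH.of_embedding ⟨⟨fun x => f x.1, ?_⟩, ?_⟩ h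
    · intro x y hxy
      exact Subtype.ext (hF.inj _ _ hxy (x.2.trans y.2.symm))
    · intro x y
      have h1 : idx x.1 = idx y.1 := x.2.trans y.2.symm
      change G.Adj (f x.1) (f y.1) ↔ F.Adj x.1 y.1
      rw [hF.same x.1 y.1 (hb _ _)]
      simp [h1]

end Additive

section Product

variable {m : ℕ} {Q : Fin m → GraphProperty}

theorem free_product (hA : ∀ i, (Q i).Additive) (hH : ∀ i, (Q i).InducedHereditary) {V : Type}
    [Finite V] {G : SimpleGraph V} {c : V → Fin m} (hc : ∀ i, (Q i).Holds (G.induce (c ⁻¹' {i}))) :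
    (product Q).Free G c := by
  intro X I _ _ F f idx hF
  refine ⟨c ∘ f, fun i => ?_⟩
  refine Additive.free_of_const (hA i) (hH i) (b := c ∘ Subtype.val) ?_ (hc i) _ _ _
    (IsBlowUp.mono_allowed (fun _ _ _ => trivial) (hF.induce (c ⁻¹' {i})))
  rintro ⟨u, hu⟩ ⟨v, hv⟩
  exact hu.trans hv.symm

/-- A free partition for a product can be refined to free partitions for the factors. -/
theorem Free.exists_factors (hH : ∀ i, (Q i).InducedHereditary) {V S : Type} [Finite V]
    {G : SimpleGraph V} {b : V → S} (h : (product Q).Free G b) :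
    ∃ d : V → Fin m, ∀ i, (Q i).Free (G.induce (d ⁻¹' {i})) (b ∘ Subtype.val) := by
  obtain ⟨d, hd⟩ := IsBlowUp.exists_uniform (G := G) (b := b) (N := fun _ _ => True) (R := Fin m)
    (fun _ _ _ => trivial)
    (fun {X} _ F χ => ∀ i, (Q i).Holds (F.induce (χ ⁻¹' {i})))
    (by
      intro X Y _ _ F F' φ χ hχ i
      refine InducedHereditary.of_embedding (hH i) ⟨⟨fun x => ⟨φ x.1, x.2⟩, ?_⟩, ?_⟩ (hχ i)
      · intro x y hxy
        exact Subtype.ext (φ.injective (congrArg Subtype.val hxy))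
      · intro x y
        exact φ.map_adj_iff)
    (by
      intro I _ F hF
      exact h F _ _ hF)
  refine ⟨d, fun i => ?_⟩
  intro X I _ _ F f idx hF
  have := hd F (Subtype.val ∘ f) idx
    (IsBlowUp.of_embedding (SimpleGraph.Embedding.induce (d ⁻¹' {i})) hF) i
  refine InducedHereditary.of_embedding (hH i) ⟨⟨fun x => ⟨x, (f x).2⟩, ?_⟩, ?_⟩ this
  · exact fun x y hxy => congrArg Subtype.val hxy
  · exact Iff.rfl

/-- A product of induced-hereditary properties, none of which holds for all graphs, does not hold
for all graphs. -/
theorem exists_not_holds_product (hH : ∀ i, (Q i).InducedHereditary) {W : Fin m → Type}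
    [∀ i, Finite (W i)] (E : ∀ i, SimpleGraph (W i)) (hE : ∀ i, ¬ (Q i).Holds (E i)) :
    ¬ ∀ {V : Type} [Finite V] (G : SimpleGraph V), (product Q).Holds G := by
  classical
  intro hall
  have := fun i => Fintype.ofFinite (W i)
  let k := ∑ i, Fintype.card (W i)
  -- With singleton blocks, any graph on a subset of the vertices is a blow-up of the edgeless
  -- graph. Some colour class has more than `k` vertices, enough room for `E i`.
  obtain ⟨d, hd⟩ := Free.exists_factors hH (G := (⊥ : SimpleGraph (Fin (m * k + 1)))) (b := id)
    (fun F _ _ _ => hall F)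
  obtain ⟨i, hi⟩ := Fintype.exists_lt_card_fiber_of_mul_lt_card (n := k) d (by simp)
  have hle : Fintype.card (W i) ≤ k :=
    Finset.single_le_sum (f := fun i => Fintype.card (W i)) (fun _ _ => Nat.zero_le _)
      (Finset.mem_univ i)
  obtain ⟨e⟩ : Nonempty (W i ↪ {v // d v = i}) := by
    apply Function.Embedding.nonempty_of_card_le
    rw [Fintype.card_subtype]
    omega
  refine hE i (hd i (E i) (fun w => ⟨(e w).1, (e w).2⟩) (fun _ => ()) ⟨?_, ?_, by simp⟩)
  · exact fun x y h _ => e.injective (Subtype.ext (congrArg Subtype.val h))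
  · intro x y h
    obtain rfl : x = y := e.injective (Subtype.ext h)
    simp

theorem Indecomposable.exists_isStrict {P : GraphProperty} (h : P.Indecomposable) :
    ∃ (V : Type) (_ : Finite V) (G : SimpleGraph V), P.IsStrict G ∧ P.decNumber G = 1 := by
  have hne : {d : ℕ∞ | ∃ (V : Type) (_ : Finite V) (G : SimpleGraph V),
      P.IsStrict G ∧ d = P.decNumber G}.Nonempty := by
    by_contra hemp
    rw [Set.not_nonempty_iff_eq_empty] at hemp
    rw [Indecomposable, dec, hemp] at h
    simp at h
  obtain ⟨V, hV, G, hG, hd⟩ := csInf_mem hne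
  refine ⟨V, hV, G, hG, ?_⟩
  have : (P.decNumber G : ℕ∞) = 1 := hd.symm.trans h
  exact_mod_cast this

theorem Indecomposable.holds_unit {P : GraphProperty} (h : P.Indecomposable)
    (hH : P.InducedHereditary) : P.Holds (⊤ : SimpleGraph Unit) := by
  obtain ⟨V, _, G, hG, hd⟩ := h.exists_isStrict
  obtain ⟨c, hc, -⟩ := exists_free_of_le_decNumber hH le_rfl hd.ge
  obtain ⟨v, -⟩ := hc 0
  exact hH.of_embedding ⟨⟨fun _ => v, fun _ _ _ => rfl⟩, by simp⟩ hG.1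

theorem le_decNumber_of_isStrict_product (hA : ∀ i, (Q i).Additive)
    (hH : ∀ i, (Q i).InducedHereditary) (hu : ∀ i, (Q i).Holds (⊤ : SimpleGraph Unit))
    {V : Type} [Finite V] {G : SimpleGraph V} (hG : (product Q).IsStrict G) :
    m ≤ (product Q).decNumber G := by
  obtain ⟨c, hc⟩ := hG.1
  have hsurj : Function.Surjective c := by
    intro i
    -- An isolated vertex can be added to part `i` by additivity; since `G` is strict, it must
    -- already meet that part.
    have hfree : (product Q).Free (G ⊕g (⊤ : SimpleGraph Unit)) (Sum.elim c fun _ => i) := by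
      refine free_product hA hH fun j => ?_
      refine Additive.holds_of_split (hA j) {x | x.1.isLeft} ?_ ?_ ?_
      · rintro ⟨x | x, hx⟩ ⟨y | y, hy⟩ hxy <;> simp_all
      · refine InducedHereditary.of_embedding (hH j) (G := G.induce {v | c v = j}) ?_ (hc j)
        refine ⟨⟨fun x => ⟨x.1.1.getLeft x.2, ?_⟩, ?_⟩, ?_⟩
        · obtain ⟨⟨x | x, hx⟩, hx'⟩ := x
          · exact hx
          · simp at hx'
        · rintro ⟨⟨x | x, hx⟩, hx'⟩ ⟨⟨y | y, hy⟩, hy'⟩ hxy <;> simp_all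
        · rintro ⟨⟨x | x, hx⟩, hx'⟩ ⟨⟨y | y, hy⟩, hy'⟩
          · exact Iff.rfl
          · exact absurd hy' (by simp)
          · exact absurd hx' (by simp)
          · exact absurd hx' (by simp)
      · refine InducedHereditary.of_embedding (hH j) ⟨⟨fun _ => (), ?_⟩, ?_⟩ (hu j)
        · rintro ⟨⟨x | x, hx⟩, hx'⟩ ⟨⟨y | y, hy⟩, hy'⟩ hxy
          · exact absurd rfl hx'
          · exact absurd rfl hx'
          · exact absurd rfl hy'
          · rfl
        · rintro ⟨⟨x | x, hx⟩, hx'⟩ ⟨⟨y | y, hy⟩, hy'⟩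
          · exact absurd rfl hx'
          · exact absurd rfl hx'
          · exact absurd rfl hy'
          · simp
    obtain ⟨v, hv⟩ := hG.exists_eq (SimpleGraph.Embedding.sumInl) hfree (Sum.inr ())
    exact ⟨v, by simpa using hv⟩
  have := Free.ncard_range_le (free_product hA hH hc)
  rw [hsurj.range_eq, Set.ncard_univ, Nat.card_fin] at this
  exact this

end Product

end GraphProperty

/-! ### Refining free labellings -/

namespace GraphProperty

section Refinement

variable {P : GraphProperty} {V S R S' : Type} {G : SimpleGraph V} {b : V → S}
  {N : V → V → Prop}

/-- If a colouring `d` lifts to free partitions of all allowed blow-ups, then refining it according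
to the blocks yields a free partition. -/
theorem Free.of_blowUps [Finite R] {d : V → R} {κ : V → S'} (hGN : ∀ u v, G.Adj u v → N u v)
    (hd : ∀ {X I : Type} [Finite X] [Finite I] (F : SimpleGraph X) (f : X → V) (idx : X → I),
      IsBlowUp G b N F f idx → P.Free F (d ∘ f))
    (hκ : ∀ u v, d u = d v → b u = b v ∨ ¬ N u v → κ u = κ v) : P.Free G κ := by
  intro X I _ _ F f idx hF
  -- Deleting the edges between different `d`-colours leaves an allowed blow-up of `G`. Then `F` is
  -- recovered as a blow-up of `F'` with the colours as blocks.
  let F' : SimpleGraph X :=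
    { Adj := fun x y => F.Adj x y ∧ d (f x) = d (f y)
      symm := ⟨fun x y h => ⟨h.1.symm, h.2.symm⟩⟩
      loopless := ⟨fun x h => F.loopless.irrefl x h.1⟩ }
  have hF' : IsBlowUp G b N F' f (fun x => (idx x, d (f x))) := by
    refine ⟨fun x y h1 h2 => hF.inj x y h1 (congrArg Prod.fst h2), fun x y hb => ?_, fun x y h => ?_⟩
    · change (F.Adj x y ∧ d (f x) = d (f y)) ↔ _
      by_cases hdd : d (f x) = d (f y)
      · rw [hF.same x y (hκ _ _ hdd (Or.inl hb))]
        simp [hdd]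
      · simp [hdd]
    · by_contra hN
      exact hN (hGN _ _ ((hF.same x y (hκ _ _ h.2 (Or.inr hN))).1 h.1).2)
  refine hd F' f _ hF' F id (fun _ => ()) ⟨fun x y h _ => h, fun x y h => ?_, by simp⟩
  have h' : d (f x) = d (f y) := h
  simp [F', h']

/-- A free partition of a supergraph of a strict graph with decomposability number at most `n`
cannot properly refine a partition into `n` nonempty parts. -/
theorem IsStrict.eq_of_surjective {V₀ : Type} [Finite V₀] [Finite V] {G₀ : SimpleGraph V₀}
    (h₀ : P.IsStrict G₀) {n : ℕ} (hn : P.decNumber G₀ ≤ n) (φ : G₀ ↪g G) {κ : V → S'}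
    (hκ : P.Free G κ) (π : S' → Fin n) (hπ : Function.Surjective (π ∘ κ)) {u v : V}
    (huv : π (κ u) = π (κ v)) : κ u = κ v := by
  have himg : (π '' Set.range κ).ncard = n := by
    rw [← Set.range_comp, hπ.range_eq, Set.ncard_univ, Nat.card_fin]
  have hinj : Set.InjOn π (Set.range κ) := by
    refine Set.injOn_of_ncard_image_eq (le_antisymm (Set.ncard_image_le (Set.finite_range κ)) ?_)
      (Set.finite_range κ)
    rw [himg]
    exact (h₀.ncard_range_le φ hκ).trans hn
  exact hinj ⟨u, rfl⟩ ⟨v, rfl⟩ huv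

/-- If every allowed blow-up has property `P`, then there is a single colouring of the base graph
that lifts to a free partition of every allowed blow-up. -/
theorem IsStrict.exists_uniform_free (hP : P.InducedHereditary) {V₀ : Type} [Finite V₀] [Finite V]
    {G₀ : SimpleGraph V₀} (h₀ : P.IsStrict G₀) {n : ℕ} (hn : 1 ≤ n)
    (hmin : ∀ (V : Type) [Finite V] (G : SimpleGraph V), P.IsStrict G → n ≤ P.decNumber G)
    (hGN : ∀ u v, G.Adj u v → N u v) (φ : G₀ ↪g G)
    (hall : ∀ {X I : Type} [Finite X] [Finite I] (F : SimpleGraph X) (f : X → V) (idx : X → I),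
      IsBlowUp G b N F f idx → P.Holds F) :
    ∃ d : V → Fin n, Function.Surjective (d ∘ φ) ∧
      ∀ {X I : Type} [Finite X] [Finite I] (F : SimpleGraph X) (f : X → V) (idx : X → I),
        IsBlowUp G b N F f idx → P.Free F (d ∘ f) := by
  obtain ⟨d, hd⟩ := IsBlowUp.exists_uniform (R := Fin n) hGN (b := b)
    (fun {X} _ F χ => P.Free F χ ∧ ∀ ψ : G₀ ↪g F, Function.Surjective (χ ∘ ψ))
    (by
      intro X Y _ _ F F' θ χ hχ
      exact ⟨Free.of_embedding hχ.1 θ, fun ψ => hχ.2 (θ.comp ψ)⟩)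
    (by
      intro I _ F hF
      -- Adding a separate copy of `G` brings in `G₀`, which makes the blow-up strict and hence
      -- decomposable into `n` parts.
      have hF₁ : IsBlowUp G b N (G ⊕g F) (Sum.elim id Prod.fst)
          (Sum.elim (fun _ => none) fun p => some p.2) := by
        refine ⟨?_, ?_, ?_⟩
        · rintro (u | p) (v | q) h1 h2
          · exact congrArg _ h1
          · simp at h2
          · simp at h2
          · exact congrArg _ (Prod.ext h1 (by simpa using h2))
        · rintro (u | p) (v | q) hb
          · simp
          · simp
          · simp
          · simpa using hF.same p q hb
        · rintro (u | p) (v | q) h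
          · exact hGN _ _ (by simpa using h)
          · simp at h
          · simp at h
          · exact hF.allowed p q (by simpa using h)
      have hstrict := h₀.mono hP (SimpleGraph.Embedding.sumInl.comp φ) (hall _ _ _ hF₁)
      obtain ⟨c, hc, hfree⟩ := exists_free_of_le_decNumber hP hn (hmin _ _ hstrict)
      refine ⟨c ∘ Sum.inr, Free.of_embedding hfree SimpleGraph.Embedding.sumInr, fun ψ i => ?_⟩
      obtain ⟨x, rfl⟩ := hc i
      exact h₀.exists_eq (SimpleGraph.Embedding.sumInr.comp ψ) hfree x)
  exact ⟨d, (hd G id _ (IsBlowUp.self hGN)).2 φ, fun F f idx hF => (hd F f idx hF).1⟩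

end Refinement

/-! ### Distributing classes among the factors -/

section Factorisation

variable {m n : ℕ} {Q : Fin m → GraphProperty} {V₀ V : Type} [Finite V₀] [Finite V]
  {G₀ : SimpleGraph V₀} {G : SimpleGraph V} {a : V → Fin n}

/-- The parts of a free partition of a supergraph of a minimal strict graph can be distributed to
the factors of a product. -/
theorem Free.exists_factor_map (hH : ∀ i, (Q i).InducedHereditary)
    (h₀ : (product Q).IsStrict G₀) (hn : (product Q).decNumber G₀ ≤ n) (φ : G₀ ↪g G)
    (ha : Function.Surjective a) (h : (product Q).Free G a) :
    ∃ τ : Fin n → Fin m, ∀ i, (Q i).Free (G.induce ((τ ∘ a) ⁻¹' {i})) (a ∘ Subtype.val) := by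
  obtain ⟨d, hd⟩ := Free.exists_factors hH h
  have hfree : (product Q).Free G (fun v => (a v, d v)) := by
    intro X I _ _ F f idx hF
    refine ⟨d ∘ f, fun i => ?_⟩
    have hi : (Q i).Free (G.induce (d ⁻¹' {i})) ((fun v => (a v, d v)) ∘ Subtype.val) :=
      Free.mono (hd i) (by
        rintro ⟨u, hu⟩ ⟨v, hv⟩ huv
        exact Prod.ext huv (hu.trans hv.symm))
    exact hi _ _ _ (IsBlowUp.mono_allowed (fun _ _ _ => trivial) (hF.induce (d ⁻¹' {i})))
  choose g hg using ha
  have hτ : d = (d ∘ g) ∘ a := by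
    funext v
    have := h₀.eq_of_surjective hn φ hfree Prod.fst (fun j => ⟨g j, hg j⟩) (u := v) (v := g (a v))
      (hg _).symm
    exact congrArg Prod.snd this
  refine ⟨d ∘ g, ?_⟩
  rw [← hτ]
  exact hd

/-- A free partition that is compatible with the factors can be extended so that the `i`-th factor
contains any given graph `H i` of this factor. -/
theorem exists_free_extension (hA : ∀ i, (Q i).Additive) (hH : ∀ i, (Q i).InducedHereditary)
    (hP : (product Q).InducedHereditary) (h₀ : (product Q).IsStrict G₀)
    (hn1 : 1 ≤ n) (hn : (product Q).decNumber G₀ ≤ n)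
    (hmin : ∀ (V : Type) [Finite V] (G : SimpleGraph V),
      (product Q).IsStrict G → n ≤ (product Q).decNumber G)
    (φ : G₀ ↪g G) (ha : Function.Surjective a) {τ : Fin n → Fin m}
    (hτ : ∀ i, (Q i).Free (G.induce ((τ ∘ a) ⁻¹' {i})) (a ∘ Subtype.val))
    {W : Fin m → Type} [∀ i, Finite (W i)] (H : ∀ i, SimpleGraph (W i))
    (hHQ : ∀ i, (Q i).Holds (H i)) :
    ∃ a' : V ⊕ (Σ i, W i) → Fin n, a' ∘ Sum.inl = a ∧
      (product Q).Free (G ⊕g disjointUnion H) a' ∧ ∀ i w, τ (a' (Sum.inr ⟨i, w⟩)) = i := by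
  let B : SimpleGraph (V ⊕ Σ i, W i) := G ⊕g disjointUnion H
  let b : V ⊕ (Σ i, W i) → Fin n ⊕ Fin m := Sum.map a Sigma.fst
  let c : V ⊕ (Σ i, W i) → Fin m := Sum.elim (τ ∘ a) Sigma.fst
  -- The only forbidden edges join `G` to the added graphs within one factor. Each factor of an
  -- allowed blow-up then splits into two unconnected pieces, and additivity applies.
  let N : V ⊕ (Σ i, W i) → V ⊕ (Σ i, W i) → Prop := fun u v => u.isLeft = v.isLeft ∨ c u ≠ c v
  have hGN : ∀ u v, B.Adj u v → N u v := by
    rintro (u | u) (v | v) h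
    · exact Or.inl rfl
    · simp [B] at h
    · simp [B] at h
    · exact Or.inl rfl
  have hleft : ∀ i, (Q i).Free (B.induce {v | c v = i ∧ v.isLeft}) (b ∘ Subtype.val) := by
    intro i
    let e : B.induce {v | c v = i ∧ v.isLeft} ↪g G.induce ((τ ∘ a) ⁻¹' {i}) :=
      { toFun := fun x => ⟨x.1.getLeft x.2.2, by
          obtain ⟨x | x, hx⟩ := x
          · exact hx.1
          · simp at hx⟩
        inj' := by
          rintro ⟨x | x, hx⟩ ⟨y | y, hy⟩ hxy
          · simpa using hxy
          · simp at hy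
          · simp at hx
          · simp at hx
        map_rel_iff' := by
          rintro ⟨x | x, hx⟩ ⟨y | y, hy⟩
          · exact Iff.rfl
          · simp at hy
          · simp at hx
          · simp at hx }
    have he : (Q i).Free (B.induce {v | c v = i ∧ v.isLeft}) ((a ∘ Subtype.val) ∘ e) :=
      Free.of_embedding (hτ i) e
    refine @Free.mono (Q i) _ _ _ _ _ _ he ?_
    rintro ⟨x | x, hx⟩ ⟨y | y, hy⟩ hxy
    · exact congrArg Sum.inl hxy
    · simp at hy
    · simp at hx
    · simp at hx
  have hright : ∀ i, (Q i).Free (B.induce {v | c v = i ∧ v.isLeft = false}) (b ∘ Subtype.val) := by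
    intro i
    refine Additive.free_of_const (hA i) (hH i) ?_ ?_
    · rintro ⟨x | x, hx⟩ ⟨y | y, hy⟩
      · simp at hx
      · simp at hx
      · simp at hy
      · exact congrArg Sum.inr (hx.1.trans hy.1.symm)
    · let e : H i ↪g B.induce {v | c v = i ∧ v.isLeft = false} :=
        { toFun := fun w => ⟨Sum.inr ⟨i, w⟩, rfl, rfl⟩
          inj' := by
            intro x y hxy
            simpa using hxy
          map_rel_iff' := by
            intro x y
            exact disjointUnion_adj_same H i x y }
      refine (Q i).iso (RelIso.ofSurjective e ?_) (hHQ i)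
      rintro ⟨x | ⟨j, x⟩, hx⟩
      · simp at hx
      · obtain rfl : j = i := hx.1
        exact ⟨x, rfl⟩
  have hall : ∀ {X I : Type} [Finite X] [Finite I] (F : SimpleGraph X)
      (f : X → V ⊕ (Σ i, W i)) (idx : X → I), IsBlowUp B b N F f idx → (product Q).Holds F := by
    intro X I _ _ F f idx hF
    refine ⟨c ∘ f, fun i => Additive.holds_of_split (hA i) {x | (f x.1).isLeft} ?_ ?_ ?_⟩
    · rintro ⟨x, hx⟩ ⟨y, hy⟩ hxy
      rcases hF.allowed x y hxy with h | h
      · simp [h]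
      · exact absurd (hx.trans hy.symm) h
    · refine InducedHereditary.of_embedding (hH i)
        ⟨⟨fun x => ⟨x.1.1, x.1.2, x.2⟩, ?_⟩, Iff.rfl⟩
        (hleft i _ _ _ (IsBlowUp.mono_allowed (fun _ _ _ => trivial) (hF.induce _)))
      intro x y hxy
      simpa [Subtype.ext_iff] using hxy
    · refine InducedHereditary.of_embedding (hH i)
        ⟨⟨fun x => ⟨x.1.1, x.1.2, Bool.eq_false_of_not_eq_true x.2⟩, ?_⟩, Iff.rfl⟩
        (hright i _ _ _ (IsBlowUp.mono_allowed (fun _ _ _ => trivial) (hF.induce _)))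
      intro x y hxy
      simpa [Subtype.ext_iff] using hxy
  obtain ⟨d, hds, hd⟩ := h₀.exists_uniform_free hP hn1 hmin hGN
    (SimpleGraph.Embedding.sumInl.comp φ) hall
  have hdl : Function.Surjective (d ∘ Sum.inl) := fun j => by
    obtain ⟨x, hx⟩ := hds j
    exact ⟨φ x, hx⟩
  -- The common refinement of `a` and `d` on `G` is free, so it has at most `n` classes; hence `d`
  -- and `a` agree there up to renaming, and `a'` undoes the renaming.
  have hfree : (product Q).Free G (fun v => (a v, d (Sum.inl v))) := by
    refine Free.of_blowUps (b := a) (N := fun _ _ => True) (d := d ∘ Sum.inl)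
      (fun _ _ _ => trivial) ?_ ?_
    · intro X I _ _ F f idx hF
      refine hd F (Sum.inl ∘ f) idx ⟨?_, ?_, fun _ _ _ => Or.inl rfl⟩
      · exact fun x y h1 h2 => hF.inj x y (Sum.inl_injective h1) h2
      · intro x y hxy
        rw [hF.same x y (Sum.inl_injective hxy)]
        simp [B]
    · rintro u v h1 (h2 | h2)
      · exact Prod.ext h2 h1
      · exact absurd trivial h2
  choose g hg using hdl
  let a' : V ⊕ (Σ i, W i) → Fin n := (a ∘ g) ∘ d
  have ha' : ∀ v, a' (Sum.inl v) = a v := fun v =>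
    congrArg Prod.fst (h₀.eq_of_surjective hn φ hfree Prod.snd (fun j => ⟨g j, hg j⟩)
      (u := g (d (Sum.inl v))) (v := v) (hg _))
  have hd' : ∀ {X I : Type} [Finite X] [Finite I] (F : SimpleGraph X)
      (f : X → V ⊕ (Σ i, W i)) (idx : X → I), IsBlowUp B b N F f idx →
        (product Q).Free F (a' ∘ f) := fun F f idx hF =>
    Free.mono (hd F f idx hF) fun u v h => congrArg (a ∘ g) h
  -- The second coordinate marks the vertices whose factor disagrees with the one `τ` gives their
  -- class. As `κ` is free, it cannot properly refine `a'`. Every class contains a vertex of `G`,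
  -- where the mark is `none`, so no vertex disagrees.
  let κ : V ⊕ (Σ i, W i) → Fin n × Option (Fin m) := fun v =>
    (a' v, if τ (a' v) = c v then none else some (c v))
  have hκ : (product Q).Free B κ := by
    refine Free.of_blowUps hGN hd' ?_
    have hc : ∀ u v, a' u = a' v → c u = c v → κ u = κ v := by
      intro u v h1 h2
      simp only [κ, h1, h2]
    intro u v h1 h2
    refine hc u v h1 ?_
    rcases h2 with h2 | h2
    · rcases u with u | u <;> rcases v with v | v
      · exact congrArg τ (Sum.inl_injective h2)
      · simp [b] at h2
      · simp [b] at h2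
      · exact Sum.inr_injective h2
    · by_contra hne
      exact h2 (Or.inr hne)
  refine ⟨a', funext ha', hd' B id _ (IsBlowUp.self hGN), fun i w => ?_⟩
  obtain ⟨v, hv⟩ := ha (a' (Sum.inr ⟨i, w⟩))
  have hvw : a' (Sum.inl v) = a' (Sum.inr ⟨i, w⟩) := (ha' v).trans hv
  have := h₀.eq_of_surjective hn (SimpleGraph.Embedding.sumInl.comp φ) hκ Prod.fst
    (fun j => (ha j).imp' Sum.inl fun v hv => (ha' v).trans hv) hvw
  have h2 := congrArg Prod.snd this
  simp only [κ] at h2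
  rw [if_pos (by rw [ha']; rfl)] at h2
  by_contra hne
  have hne' : ¬ τ (a' (Sum.inr ⟨i, w⟩)) = c (Sum.inr ⟨i, w⟩) := hne
  rw [if_neg hne'] at h2
  simp at h2

theorem le_of_forall_isStrict (hA : ∀ i, (Q i).Additive) (hH : ∀ i, (Q i).InducedHereditary)
    (hI : ∀ i, (Q i).Indecomposable) (hP : (product Q).InducedHereditary)
    (h₀ : (product Q).IsStrict G₀) (hn : (product Q).decNumber G₀ ≤ n)
    (hmin : ∀ (V : Type) [Finite V] (G : SimpleGraph V),
      (product Q).IsStrict G → n ≤ (product Q).decNumber G) : n ≤ m := by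
  rcases Nat.eq_zero_or_pos n with rfl | hn1
  · exact Nat.zero_le m
  -- The maps compatible with a labelling. Restriction shows that enlarging the graph can only lose
  -- some, so minimising their number prevents any loss.
  let T {V : Type} (G : SimpleGraph V) (a : V → Fin n) : Set (Fin n → Fin m) :=
    {τ | ∀ i, (Q i).Free (G.induce ((τ ∘ a) ⁻¹' {i})) (a ∘ Subtype.val)}
  let Good : ℕ → Prop := fun t => ∃ (V : Type) (_ : Finite V) (G : SimpleGraph V) (a : V → Fin n),
    Function.Surjective a ∧ (product Q).Free G a ∧ Nonempty (G₀ ↪g G) ∧ (T G a).ncard = t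
  have hex : ∃ t, Good t := by
    obtain ⟨c, hc, hfree⟩ := exists_free_of_le_decNumber hP hn1 (hmin _ _ h₀)
    exact ⟨_, V₀, inferInstance, G₀, c, hc, hfree, ⟨SimpleGraph.Embedding.refl⟩, rfl⟩
  classical
  obtain ⟨V, _, G, a, ha, hfree, ⟨φ⟩, hT⟩ := Nat.find_spec hex
  obtain ⟨τ, hτ⟩ := hfree.exists_factor_map hH h₀ hn φ ha
  choose W hW H hHs hHd using fun i => (hI i).exists_isStrict
  obtain ⟨a', rfl, hfree', hτ'⟩ := exists_free_extension hA hH hP h₀ hn1 hn hmin φ ha hτ H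
    fun i => (hHs i).1
  have ha' : Function.Surjective a' := ha.of_comp
  have hsub : T (G ⊕g disjointUnion H) a' ⊆ T G (a' ∘ Sum.inl) := by
    intro σ hσ i
    exact Free.of_embedding (hσ i)
      (⟨⟨fun x => ⟨Sum.inl x.1, x.2⟩, fun x y h => Subtype.ext
        (Sum.inl_injective (congrArg Subtype.val h))⟩, Iff.rfl⟩ :
        G.induce ((σ ∘ a' ∘ Sum.inl) ⁻¹' {i}) ↪g
          (G ⊕g disjointUnion H).induce ((σ ∘ a') ⁻¹' {i}))
  have hTeq : T (G ⊕g disjointUnion H) a' = T G (a' ∘ Sum.inl) := by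
    refine Set.eq_of_subset_of_ncard_le hsub ?_ (Set.toFinite _)
    rw [hT]
    exact Nat.find_min' hex ⟨_, inferInstance, _, a', ha', hfree',
      ⟨SimpleGraph.Embedding.sumInl.comp φ⟩, rfl⟩
  have hτT : τ ∈ T (G ⊕g disjointUnion H) a' := hTeq ▸ hτ
  have hinj : Function.Injective τ := by
    intro j j' hjj
    let e : H (τ j) ↪g (G ⊕g disjointUnion H).induce ((τ ∘ a') ⁻¹' {τ j}) :=
      { toFun := fun w => ⟨Sum.inr ⟨τ j, w⟩, hτ' _ w⟩
        inj' := by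
          intro x y hxy
          simpa [Subtype.ext_iff] using hxy
        map_rel_iff' := by
          intro x y
          exact disjointUnion_adj_same H _ x y }
    -- The classes sent to the factor `τ j` form a free labelling of a graph containing `H (τ j)`,
    -- whose decomposability number is `1`; so there is only one such class.
    have hle := (hHs (τ j)).ncard_range_le e (hτT (τ j))
    rw [hHd, Set.ncard_le_one (Set.finite_range _)] at hle
    obtain ⟨v, rfl⟩ := ha' j
    obtain ⟨v', rfl⟩ := ha' j'
    exact hle _ ⟨⟨v, rfl⟩, rfl⟩ _ ⟨⟨v', hjj.symm⟩, rfl⟩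
  simpa using Fintype.card_le_of_injective τ hinj

end Factorisation

end GraphProperty

/-! ### The main theorem -/

theorem mainTheorem3 (m : ℕ) (P : GraphProperty) (Q : Fin m → GraphProperty)
    (hP_add : P.Additive) (hP_her : P.InducedHereditary)
    (hQ_add : ∀ i, (Q i).Additive) (hQ_her : ∀ i, (Q i).InducedHereditary)
    (hQ_ind : ∀ i, (Q i).Indecomposable)
    (hfac : P = GraphProperty.product Q) :
    (m : ℕ∞) = P.dec := by
  subst hfac
  apply le_antisymm
  · refine le_sInf ?_
    rintro d ⟨V, _, G, hG, rfl⟩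
    exact_mod_cast GraphProperty.le_decNumber_of_isStrict_product hQ_add hQ_her
      (fun i => (hQ_ind i).holds_unit (hQ_her i)) hG
  · have hne : {d : ℕ∞ | ∃ (V : Type) (_ : Finite V) (G : SimpleGraph V),
        (GraphProperty.product Q).IsStrict G ∧
          d = (GraphProperty.product Q).decNumber G}.Nonempty := by
      -- Without strict graphs the product would contain every graph. But each factor misses some
      -- graph `E i`, and then the product also misses one.
      by_contra hemp
      have hnone : ∀ (V : Type) [Finite V] (G : SimpleGraph V),
          ¬ (GraphProperty.product Q).IsStrict G :=
        fun V _ G hG => hemp ⟨_, V, inferInstance, G, hG, rfl⟩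
      choose W hW H hHs hHd using fun i => (hQ_ind i).exists_isStrict
      have hstrict := fun i => (hHs i).2
      push Not at hstrict
      choose E _ hE using hstrict
      refine GraphProperty.exists_not_holds_product hQ_her E hE ?_
      refine GraphProperty.holds_of_forall_not_isStrict (G₀ := (⊥ : SimpleGraph Empty)) hP_her
        ⟨Empty.elim, fun i => ?_⟩ hnone
      exact GraphProperty.InducedHereditary.of_embedding (hQ_her i)
        ⟨⟨fun x => x.1.elim, fun x => x.1.elim⟩, fun {x} => x.1.elim⟩ (hHs i).1
    obtain ⟨V, _, G, hG, hd⟩ := csInf_mem hne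
    have hdec : (GraphProperty.product Q).dec = (GraphProperty.product Q).decNumber G := hd
    rw [hdec]
    refine Nat.cast_le.2 (GraphProperty.le_of_forall_isStrict hQ_add hQ_her hQ_ind hP_her hG
      le_rfl fun V' _ G' hG' => ?_)
    have : (GraphProperty.product Q).dec ≤ (GraphProperty.product Q).decNumber G' :=
      sInf_le ⟨V', inferInstance, G', hG', rfl⟩
    rw [hdec] at this
    exact_mod_cast this
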